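/- Let $\ell_2$ be the real or the complex Hilbert space of square-summable sequences indexed by $\mathbb N$, with canonical orthonormal basis $\{e_i\}$. A sequence $\{x_k\}_{k=1}^\infty$ in $\ell_2$ is a frame if there are constants $0<A\le B<\infty$ with $A\|x\|^2\le\sum_{k}|\langle x,x_k\rangle|^2\le B\|x\|^2$ for all $x\in\ell_2$. A bounded linear operator $T$ on $\ell_2$ is Hilbert–Schmidt if $\sum_{i,j}|\langle Te_j,e_i\rangle|^2<\infty$. The sequence $\{x_k\}$ is injective if the only self-adjoint Hilbert–Schmidt operator $T$ with $\langle Tx_k,x_k\rangle=0$ for all $k$ is $T=0$. Theorem. There is no injective frame $\{x_k\}_{k=1}^\infty$ for the real or complex space $\ell_2$ such that for every real sequence $a=\{a_k\}_{k=1}^\infty\in\ell_2$ there is a Hilbert–Schmidt operator $T$ on $\ell_2$ (not required to be self-adjoint) with \[ \langle Tx_k,x_k\rangle=a_k\quad\text{for all } k=1,2,\dots. \] -/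

import Mathlib

open scoped lp

namespace StateEstimation

/-- The family `x` is a frame for the Hilbert space `H`:
`A ‖y‖² ≤ ∑ₖ |⟨y, xₖ⟩|² ≤ B ‖y‖²` for all `y`, with constants `0 < A ≤ B < ∞`. -/
def IsFrame (𝕜 : Type*) [RCLike 𝕜] {H : Type*} [NormedAddCommGroup H] [InnerProductSpace 𝕜 H]
    {ι : Type*} (x : ι → H) : Prop :=
  ∃ A B : ℝ, 0 < A ∧ A ≤ B ∧ ∀ y : H,
    Summable (fun k => ‖inner 𝕜 y (x k)‖ ^ 2) ∧
    A * ‖y‖ ^ 2 ≤ ∑' k, ‖inner 𝕜 y (x k)‖ ^ 2 ∧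
    ∑' k, ‖inner 𝕜 y (x k)‖ ^ 2 ≤ B * ‖y‖ ^ 2

/-- A bounded operator on `ℓ₂` is Hilbert–Schmidt if its matrix
`aᵢⱼ = (T eⱼ)ᵢ` with respect to the canonical orthonormal basis satisfies `∑ᵢⱼ |aᵢⱼ|² < ∞`. -/
def IsHilbertSchmidt {𝕜 : Type*} [RCLike 𝕜] (T : ℓ²(ℕ, 𝕜) →L[𝕜] ℓ²(ℕ, 𝕜)) : Prop :=
  Summable (fun p : ℕ × ℕ => ‖(T (lp.single 2 p.2 (1 : 𝕜))) p.1‖ ^ 2)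

/-- A family of vectors `x` in `ℓ₂` is injective if the only self-adjoint Hilbert–Schmidt
operator `T` with `⟨T xₖ, xₖ⟩ = 0` for all `k` is `T = 0`. (`inner` is linear in its second
argument, so `⟨T xₖ, xₖ⟩`, linear in the first argument, is `inner 𝕜 (x k) (T (x k))`.) -/
def IsInjective {𝕜 : Type*} [RCLike 𝕜] {ι : Type*} (x : ι → ℓ²(ℕ, 𝕜)) : Prop :=
  ∀ T : ℓ²(ℕ, 𝕜) →L[𝕜] ℓ²(ℕ, 𝕜), IsHilbertSchmidt T → IsSelfAdjoint T →
    (∀ k, inner 𝕜 (x k) (T (x k)) = 0) → T = 0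

end StateEstimation

namespace StateEstimation

variable {𝕜 : Type*} [RCLike 𝕜] {ι κ : Type*}

/-! For a frame, `A ↦ (⟨A xₖ, xₖ⟩)ₖ` is a bounded real-linear map from Hermitian square-summable
matrices to real `ℓ₂`. Injectivity of the family makes it injective. Solvability for every real `a`
makes it onto, since the Hermitian part of a solution is again a solution. By the open mapping
theorem it is then bounded below. The matrices of `e₀ ⊗ eⱼ + eⱼ ⊗ e₀`, `j ≥ 1`, contradict this:
their norms are at least 1, yet their images have summable squared norms
(`IsBessel.sum_norm_measure_crossMatrix_sq_le`). Only the upper frame bound is used. -/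

theorem lp_hasSum_norm_sq (f : ℓ²(ι, 𝕜)) : HasSum (fun i => ‖f i‖ ^ 2) (‖f‖ ^ 2) := by
  simpa using lp.hasSum_norm (p := 2) (by simp) f

theorem memℓp_two_of_summable {f : ι → 𝕜} (h : Summable fun i => ‖f i‖ ^ 2) : Memℓp f 2 :=
  memℓp_gen (by simpa using h)

/-! ### Operators with square-summable matrices -/

/-- The vector whose entries are the conjugates of the `i`-th row of a square-summable matrix. -/
noncomputable def conjRow (A : ℓ²(ι × κ, 𝕜)) (i : ι) : ℓ²(κ, 𝕜) :=
  ⟨fun j => star (A (i, j)), memℓp_two_of_summable (by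
    simpa using (lp_hasSum_norm_sq A).summable.prod_factor i)⟩

theorem conjRow_apply (A : ℓ²(ι × κ, 𝕜)) (i : ι) (j : κ) : conjRow A i j = star (A (i, j)) := rfl

theorem conjRow_add (A A' : ℓ²(ι × κ, 𝕜)) (i : ι) :
    conjRow (A + A') i = conjRow A i + conjRow A' i := by
  ext j
  simp [conjRow_apply]

theorem conjRow_smul (c : ℝ) (A : ℓ²(ι × κ, 𝕜)) (i : ι) :
    conjRow (c • A) i = c • conjRow A i := by
  ext j
  simp [conjRow_apply]

theorem hasSum_norm_conjRow_sq (A : ℓ²(ι × κ, 𝕜)) :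
    HasSum (fun i => ‖conjRow A i‖ ^ 2) (‖A‖ ^ 2) :=
  (lp_hasSum_norm_sq A).prod_fiberwise fun i => by
    simpa [conjRow_apply] using lp_hasSum_norm_sq (conjRow A i)

theorem norm_inner_conjRow_sq_le (A : ℓ²(ι × κ, 𝕜)) (y : ℓ²(κ, 𝕜)) (i : ι) :
    ‖inner 𝕜 (conjRow A i) y‖ ^ 2 ≤ ‖conjRow A i‖ ^ 2 * ‖y‖ ^ 2 := by
  rw [← mul_pow]
  gcongr
  exact norm_inner_le_norm _ _

theorem summable_norm_inner_conjRow_sq (A : ℓ²(ι × κ, 𝕜)) (y : ℓ²(κ, 𝕜)) :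
    Summable fun i => ‖inner 𝕜 (conjRow A i) y‖ ^ 2 :=
  .of_nonneg_of_le (fun _ => by positivity) (norm_inner_conjRow_sq_le A y)
    ((hasSum_norm_conjRow_sq A).summable.mul_right _)

/-- The linear map on `ℓ₂` with a given square-summable matrix. -/
noncomputable def matrixLinearMap (A : ℓ²(ι × κ, 𝕜)) : ℓ²(κ, 𝕜) →ₗ[𝕜] ℓ²(ι, 𝕜) where
  toFun y := ⟨fun i => inner 𝕜 (conjRow A i) y,
    memℓp_two_of_summable (summable_norm_inner_conjRow_sq A y)⟩
  map_add' y z := by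
    ext i
    exact inner_add_right _ _ _
  map_smul' c y := by
    ext i
    exact inner_smul_right _ _ _

/-- The bounded operator on `ℓ₂` with a given square-summable matrix. -/
noncomputable def matrixOp (A : ℓ²(ι × κ, 𝕜)) : ℓ²(κ, 𝕜) →L[𝕜] ℓ²(ι, 𝕜) :=
  (matrixLinearMap A).mkContinuous ‖A‖ fun y => by
    rw [← sq_le_sq₀ (norm_nonneg _) (by positivity), mul_pow]
    exact hasSum_le (norm_inner_conjRow_sq_le A y) (lp_hasSum_norm_sq (matrixLinearMap A y))
      ((hasSum_norm_conjRow_sq A).mul_right _)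

theorem matrixOp_apply (A : ℓ²(ι × κ, 𝕜)) (y : ℓ²(κ, 𝕜)) (i : ι) :
    matrixOp A y i = inner 𝕜 (conjRow A i) y := rfl

theorem matrixOp_add (A A' : ℓ²(ι × κ, 𝕜)) (y : ℓ²(κ, 𝕜)) :
    matrixOp (A + A') y = matrixOp A y + matrixOp A' y := by
  ext i
  simp [matrixOp_apply, conjRow_add, inner_add_left]

theorem matrixOp_smul (c : ℝ) (A : ℓ²(ι × κ, 𝕜)) (y : ℓ²(κ, 𝕜)) :
    matrixOp (c • A) y = c • matrixOp A y := by
  ext i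
  simp only [matrixOp_apply, conjRow_smul, lp.coeFn_smul, Pi.smul_apply]
  rw [RCLike.real_smul_eq_coe_smul (K := 𝕜), inner_smul_left, RCLike.conj_ofReal,
    RCLike.real_smul_eq_coe_mul]

theorem matrixOp_single [DecidableEq κ] (A : ℓ²(ι × κ, 𝕜)) (i : ι) (j : κ) :
    matrixOp A (lp.single 2 j (1 : 𝕜)) i = A (i, j) := by
  rw [matrixOp_apply, lp.inner_single_right, conjRow_apply]
  simp

theorem matrixOp_matrix_single [DecidableEq ι] [DecidableEq κ] (i : ι) (j : κ) (y : ℓ²(κ, 𝕜)) :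
    matrixOp (lp.single 2 (i, j) (1 : 𝕜)) y = lp.single 2 i (y j) := by
  have h : ∀ l, conjRow (lp.single 2 (i, j) (1 : 𝕜)) l = if l = i then lp.single 2 j 1 else 0 := by
    intro l
    ext m
    split_ifs with hl
    · subst hl
      by_cases hm : m = j <;> simp [conjRow_apply, lp.single_apply, hm]
    · simp [conjRow_apply, lp.single_apply, hl]
  ext l
  rw [matrixOp_apply, h]
  by_cases hl : l = i
  · subst hl
    rw [if_pos rfl, lp.inner_single_left]
    simp
  · simp [hl, lp.single_apply]

theorem ext_of_matrix [DecidableEq κ] {S T : ℓ²(κ, 𝕜) →L[𝕜] ℓ²(ι, 𝕜)}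
    (h : ∀ i j, S (lp.single 2 j (1 : 𝕜)) i = T (lp.single 2 j (1 : 𝕜)) i) : S = T := by
  ext1 y
  have hy := lp.hasSum_single (p := 2) (by simp) y
  have key : ∀ j, S (lp.single 2 j (y j)) = T (lp.single 2 j (y j)) := by
    intro j
    have : lp.single 2 j (y j) = y j • (lp.single 2 j (1 : 𝕜) : ℓ²(κ, 𝕜)) := by
      rw [← lp.single_smul]
      simp
    rw [this, map_smul, map_smul]
    congr 1
    ext i
    exact h i j
  refine (hy.mapL S).unique ?_
  simpa only [key] using hy.mapL T

theorem adjoint_single_apply [DecidableEq κ] (T : ℓ²(κ, 𝕜) →L[𝕜] ℓ²(κ, 𝕜)) (i j : κ) :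
    T.adjoint (lp.single 2 j (1 : 𝕜)) i = star (T (lp.single 2 i (1 : 𝕜)) j) := by
  have h := ContinuousLinearMap.adjoint_inner_right T (lp.single 2 i (1 : 𝕜))
    (lp.single 2 j (1 : 𝕜))
  rw [lp.inner_single_left, lp.inner_single_right] at h
  simpa using h

/-! ### Hermitian matrices -/

/-- The real space of Hermitian square-summable matrices. -/
def hermitianMatrices (κ 𝕜 : Type*) [RCLike 𝕜] : Submodule ℝ ℓ²(κ × κ, 𝕜) where
  carrier := {A | ∀ i j, A (i, j) = star (A (j, i))}
  add_mem' {A A'} hA hA' i j := by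
    simp only [lp.coeFn_add, Pi.add_apply, star_add]
    rw [hA, hA']
  zero_mem' i j := by simp
  smul_mem' c A hA i j := by
    simp only [lp.coeFn_smul, Pi.smul_apply]
    rw [hA i j, star_smul]
    simp

theorem isClosed_hermitianMatrices :
    IsClosed (hermitianMatrices κ 𝕜 : Set ℓ²(κ × κ, 𝕜)) := by
  have hc : ∀ p : κ × κ, Continuous fun A : ℓ²(κ × κ, 𝕜) => A p := fun p =>
    (continuous_apply p).comp lp.uniformContinuous_coe.continuous
  have : (hermitianMatrices κ 𝕜 : Set ℓ²(κ × κ, 𝕜)) =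
      ⋂ (i) (j), {A | A (i, j) = star (A (j, i))} := by
    ext A
    simp [hermitianMatrices]
  rw [this]
  exact isClosed_iInter fun i => isClosed_iInter fun j =>
    isClosed_eq (hc _) (continuous_star.comp (hc _))

theorem isSelfAdjoint_matrixOp [DecidableEq κ] {A : ℓ²(κ × κ, 𝕜)}
    (hA : A ∈ hermitianMatrices κ 𝕜) : IsSelfAdjoint (matrixOp A) := by
  rw [ContinuousLinearMap.isSelfAdjoint_iff']
  refine ext_of_matrix fun i j => ?_
  rw [adjoint_single_apply, matrixOp_single, matrixOp_single, hA i j]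

theorem isHilbertSchmidt_matrixOp (A : ℓ²(ℕ × ℕ, 𝕜)) : IsHilbertSchmidt (matrixOp A) := by
  simpa only [IsHilbertSchmidt, matrixOp_single] using (lp_hasSum_norm_sq A).summable

/-- The Hermitian part of a Hilbert–Schmidt operator is given by a Hermitian matrix. -/
theorem IsHilbertSchmidt.exists_hermitian {T : ℓ²(ℕ, 𝕜) →L[𝕜] ℓ²(ℕ, 𝕜)}
    (hT : IsHilbertSchmidt T) : ∃ A ∈ hermitianMatrices ℕ 𝕜,
      ∀ y, RCLike.re (inner 𝕜 y (matrixOp A y)) = RCLike.re (inner 𝕜 y (T y)) := by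
  let M : ℓ²(ℕ × ℕ, 𝕜) := ⟨fun p => T (lp.single 2 p.2 1) p.1, memℓp_two_of_summable hT⟩
  let N : ℓ²(ℕ × ℕ, 𝕜) := ⟨fun p => star (T (lp.single 2 p.1 1) p.2),
    memℓp_two_of_summable (by
      simpa [Function.comp_def] using (Equiv.prodComm ℕ ℕ).summable_iff.2 hT)⟩
  have hM : matrixOp M = T := ext_of_matrix fun i j => matrixOp_single M i j
  have hN : matrixOp N = T.adjoint := ext_of_matrix fun i j => by
    rw [adjoint_single_apply, matrixOp_single]
  -- The matrix of `(T + T*)/2`.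
  refine ⟨(2⁻¹ : ℝ) • (M + N), Submodule.smul_mem _ _ fun i j => ?_, fun y => ?_⟩
  · change T (lp.single 2 j 1) i + star (T (lp.single 2 i 1) j) =
      star (T (lp.single 2 i 1) j + star (T (lp.single 2 j 1) i))
    rw [star_add, star_star, add_comm]
  · rw [matrixOp_smul, matrixOp_add, hM, hN, RCLike.real_smul_eq_coe_smul (K := 𝕜),
      inner_smul_right, inner_add_right, ContinuousLinearMap.adjoint_inner_right,
      RCLike.re_ofReal_mul, map_add, inner_re_symm (T y)]
    ring

/-! ### Quadratic forms on Bessel families -/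

/-- `x` is a Bessel family with bound `B`. -/
def IsBessel (𝕜 : Type*) [RCLike 𝕜] {H : Type*} [NormedAddCommGroup H] [InnerProductSpace 𝕜 H]
    (x : ι → H) (B : ℝ) : Prop :=
  ∀ y : H, ∀ s : Finset ι, ∑ k ∈ s, ‖inner 𝕜 y (x k)‖ ^ 2 ≤ B * ‖y‖ ^ 2

theorem IsFrame.exists_isBessel {H : Type*} [NormedAddCommGroup H] [InnerProductSpace 𝕜 H]
    {x : ι → H} (hx : IsFrame 𝕜 x) : ∃ B, 0 < B ∧ IsBessel 𝕜 x B := by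
  obtain ⟨A, B, hA, hAB, h⟩ := hx
  exact ⟨B, hA.trans_le hAB, fun y s =>
    ((h y).1.sum_le_tsum s fun _ _ => by positivity).trans (h y).2.2⟩

/-- Testing the Bessel inequality on `x k` itself gives `‖xₖ‖⁴ ≤ B ‖xₖ‖²`. -/
theorem IsBessel.norm_sq_le {H : Type*} [NormedAddCommGroup H] [InnerProductSpace 𝕜 H]
    {x : ι → H} {B : ℝ} (hB : 0 ≤ B) (hx : IsBessel 𝕜 x B) (k : ι) : ‖x k‖ ^ 2 ≤ B := by
  have h := hx (x k) {k}
  rw [Finset.sum_singleton, inner_self_eq_norm_sq_to_K] at h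
  rcases eq_or_lt_of_le (sq_nonneg ‖x k‖) with h0 | h0
  · rwa [← h0]
  · refine le_of_mul_le_mul_right ?_ h0
    simpa [sq] using h

/-- Apply the Bessel inequality to each conjugated row of `A`, then sum over the rows. -/
theorem IsBessel.sum_norm_matrixOp_sq_le {x : ι → ℓ²(κ, 𝕜)} {B : ℝ} (hx : IsBessel 𝕜 x B)
    (A : ℓ²(κ × κ, 𝕜)) (s : Finset ι) : ∑ k ∈ s, ‖matrixOp A (x k)‖ ^ 2 ≤ B * ‖A‖ ^ 2 :=
  hasSum_le (fun i => hx (conjRow A i) s)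
    (hasSum_sum fun k _ => lp_hasSum_norm_sq (matrixOp A (x k)))
    ((hasSum_norm_conjRow_sq A).mul_left B)

theorem IsBessel.sum_re_inner_matrixOp_sq_le {x : ι → ℓ²(κ, 𝕜)} {B : ℝ} (hB : 0 ≤ B)
    (hx : IsBessel 𝕜 x B) (A : ℓ²(κ × κ, 𝕜)) (s : Finset ι) :
    ∑ k ∈ s, ‖RCLike.re (inner 𝕜 (x k) (matrixOp A (x k)))‖ ^ 2 ≤ (B * ‖A‖) ^ 2 := by
  calc _ ≤ ∑ k ∈ s, B * ‖matrixOp A (x k)‖ ^ 2 := by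
        refine Finset.sum_le_sum fun k _ => ?_
        calc _ ≤ (‖x k‖ * ‖matrixOp A (x k)‖) ^ 2 := by
              gcongr
              exact (RCLike.norm_re_le_norm _).trans (norm_inner_le_norm _ _)
          _ ≤ _ := by
              rw [mul_pow]
              gcongr
              exact hx.norm_sq_le hB k
    _ ≤ B * (B * ‖A‖ ^ 2) := by
        rw [← Finset.mul_sum]
        gcongr
        exact hx.sum_norm_matrixOp_sq_le A s
    _ = _ := by ring

/-- The map taking a matrix to the sequence of its quadratic form values on a Bessel family. -/
noncomputable def IsBessel.measure {x : ι → ℓ²(κ, 𝕜)} {B : ℝ} (hB : 0 ≤ B)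
    (hx : IsBessel 𝕜 x B) : ℓ²(κ × κ, 𝕜) →L[ℝ] ℓ²(ι, ℝ) :=
  LinearMap.mkContinuous
    { toFun A := ⟨fun k => RCLike.re (inner 𝕜 (x k) (matrixOp A (x k))),
        memℓp_gen' (C := (B * ‖A‖) ^ 2) fun s => by
          simpa using hx.sum_re_inner_matrixOp_sq_le hB A s⟩
      map_add' A A' := by
        ext k
        change RCLike.re (inner 𝕜 (x k) (matrixOp (A + A') (x k))) = _
        rw [matrixOp_add, inner_add_right, map_add]
        rfl
      map_smul' c A := by
        ext k
        change RCLike.re (inner 𝕜 (x k) (matrixOp (c • A) (x k))) = _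
        rw [matrixOp_smul, RCLike.real_smul_eq_coe_smul (K := 𝕜), inner_smul_right,
          RCLike.re_ofReal_mul]
        rfl }
    B fun A => lp.norm_le_of_forall_sum_le (by simp) (by positivity) fun s => by
      simpa using hx.sum_re_inner_matrixOp_sq_le hB A s

theorem IsBessel.measure_apply {x : ι → ℓ²(κ, 𝕜)} {B : ℝ} (hB : 0 ≤ B)
    (hx : IsBessel 𝕜 x B) (A : ℓ²(κ × κ, 𝕜)) (k : ι) :
    hx.measure hB A k = RCLike.re (inner 𝕜 (x k) (matrixOp A (x k))) := rfl

/-! ### The cross matrices -/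

/-- The matrix of `e₀ ⊗ e_j + e_j ⊗ e₀`. -/
noncomputable def crossMatrix (𝕜 : Type*) [RCLike 𝕜] (j : ℕ) : ℓ²(ℕ × ℕ, 𝕜) :=
  lp.single 2 (0, j) 1 + lp.single 2 (j, 0) 1

theorem crossMatrix_mem (j : ℕ) : crossMatrix 𝕜 j ∈ hermitianMatrices ℕ 𝕜 := by
  intro i l
  simp only [crossMatrix, lp.coeFn_add, Pi.add_apply, lp.single_apply, Pi.single_apply,
    Prod.mk.injEq]
  rw [star_add, add_comm]
  congr 1 <;> simp only [and_comm (a := l = _)] <;> split_ifs <;> simp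

theorem one_le_norm_crossMatrix (j : ℕ) : 1 ≤ ‖crossMatrix 𝕜 (j + 1)‖ := by
  refine le_trans (le_of_eq ?_) (lp.norm_apply_le_norm (by simp) (crossMatrix 𝕜 (j + 1)) (0, j + 1))
  simp [crossMatrix, lp.single_apply]

theorem norm_re_inner_crossMatrix_le (j : ℕ) (y : ℓ²(ℕ, 𝕜)) :
    ‖RCLike.re (inner 𝕜 y (matrixOp (crossMatrix 𝕜 j) y))‖ ≤ 2 * (‖y 0‖ * ‖y j‖) := by
  refine (RCLike.norm_re_le_norm _).trans ?_
  rw [crossMatrix, matrixOp_add, matrixOp_matrix_single, matrixOp_matrix_single, inner_add_right,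
    lp.inner_single_right, lp.inner_single_right]
  refine (norm_add_le _ _).trans ((add_le_add (norm_inner_le_norm _ _)
    (norm_inner_le_norm _ _)).trans_eq ?_)
  ring

/-- For fixed `k`, summing `4 |xₖ(0)|² |xₖ(j+1)|²` over `j` gives at most `4B |xₖ(0)|²`. As `xₖ(0)`
is the inner product with `e₀`, the Bessel inequality at `e₀` bounds the sum over `k`, independently
of `n`. -/
theorem IsBessel.sum_norm_measure_crossMatrix_sq_le {x : ι → ℓ²(ℕ, 𝕜)} {B : ℝ} (hB : 0 ≤ B)
    (hx : IsBessel 𝕜 x B) (n : ℕ) :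
    ∑ j ∈ Finset.range n, ‖hx.measure hB (crossMatrix 𝕜 (j + 1))‖ ^ 2 ≤ 4 * B ^ 2 := by
  refine hasSum_le_of_sum_le
    (hasSum_sum fun j _ => lp_hasSum_norm_sq (hx.measure hB (crossMatrix 𝕜 (j + 1)))) fun s => ?_
  calc _ ≤ ∑ k ∈ s, 4 * B * ‖inner 𝕜 (lp.single 2 0 (1 : 𝕜)) (x k)‖ ^ 2 := by
        refine Finset.sum_le_sum fun k _ => ?_
        calc _ ≤ ∑ j ∈ Finset.range n, 4 * ‖x k 0‖ ^ 2 * ‖x k (j + 1)‖ ^ 2 := by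
              refine Finset.sum_le_sum fun j _ => ?_
              rw [IsBessel.measure_apply]
              calc _ ≤ (2 * (‖x k 0‖ * ‖x k (j + 1)‖)) ^ 2 := by
                    gcongr
                    exact norm_re_inner_crossMatrix_le _ _
                _ = _ := by ring
          _ ≤ 4 * ‖x k 0‖ ^ 2 * B := by
              rw [← Finset.mul_sum]
              gcongr
              refine le_trans ?_ (hx.norm_sq_le hB k)
              have h := sum_le_hasSum ((Finset.range n).map (addRightEmbedding 1))
                (fun _ _ => by positivity) (lp_hasSum_norm_sq (x k))
              simpa using h
          _ = _ := by
              rw [lp.inner_single_left]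
              simp
              ring
    _ ≤ 4 * B * (B * ‖(lp.single 2 0 (1 : 𝕜) : ℓ²(ℕ, 𝕜))‖ ^ 2) := by
        rw [← Finset.mul_sum]
        gcongr
        exact hx _ s
    _ = _ := by
        rw [lp.norm_single (by simp)]
        simp
        ring

end StateEstimation

open StateEstimation in
theorem mainTheorem1 (𝕜 : Type*) [RCLike 𝕜] :
    ¬ ∃ x : ℕ → ℓ²(ℕ, 𝕜),
        StateEstimation.IsFrame 𝕜 x ∧ StateEstimation.IsInjective x ∧
        ∀ a : ℓ²(ℕ, ℝ), ∃ T : ℓ²(ℕ, 𝕜) →L[𝕜] ℓ²(ℕ, 𝕜),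
          StateEstimation.IsHilbertSchmidt T ∧
          ∀ k : ℕ, inner 𝕜 (x k) (T (x k)) = ((a k : ℝ) : 𝕜) := by
  rintro ⟨x, hframe, hinj, hsurj⟩
  obtain ⟨B, hB, hx⟩ := hframe.exists_isBessel
  let Φ := (hx.measure hB.le).comp (hermitianMatrices ℕ 𝕜).subtypeL
  have : CompleteSpace (hermitianMatrices ℕ 𝕜) :=
    isClosed_hermitianMatrices.completeSpace_coe
  have Φ_surj : Function.Surjective Φ := by
    intro a
    obtain ⟨T, hT, hTa⟩ := hsurj a
    obtain ⟨A, hA, hAT⟩ := hT.exists_hermitian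
    refine ⟨⟨A, hA⟩, ?_⟩
    ext k
    change RCLike.re (inner 𝕜 (x k) (matrixOp A (x k))) = a k
    rw [hAT, hTa, RCLike.ofReal_re]
  have Φ_inj : Function.Injective Φ := by
    refine (injective_iff_map_eq_zero Φ).2 fun A hA => ?_
    have hsa := isSelfAdjoint_matrixOp A.2
    have h0 : matrixOp A.1 = 0 := by
      refine hinj _ (isHilbertSchmidt_matrixOp _) hsa fun k => ?_
      have hk : RCLike.re (inner 𝕜 (x k) (matrixOp A.1 (x k))) = 0 :=
        congrFun (congrArg Subtype.val hA) k
      -- The quadratic form of a self-adjoint operator is real, so a vanishing real part suffices.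
      refine (hsa.isSymmetric.coe_re_inner_self_apply (x k)).symm.trans ?_
      exact (congrArg _ hk).trans RCLike.ofReal_zero
    ext p
    rw [← matrixOp_single A.1 p.1 p.2, h0]
    simp
  obtain ⟨C, hC, hbound⟩ := Φ.exists_preimage_norm_le Φ_surj
  have hlow : ∀ j : ℕ, 1 ≤ C ^ 2 * ‖hx.measure hB.le (crossMatrix 𝕜 (j + 1))‖ ^ 2 := by
    intro j
    obtain ⟨A, hA, hAC⟩ := hbound (Φ ⟨_, crossMatrix_mem (j + 1)⟩)
    -- By injectivity, the norm-controlled preimage is the cross matrix itself.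
    rw [Φ_inj hA] at hAC
    rw [← mul_pow]
    exact one_le_pow₀ ((one_le_norm_crossMatrix j).trans hAC)
  obtain ⟨n, hn⟩ := exists_nat_gt (C ^ 2 * (4 * B ^ 2))
  refine hn.not_ge ?_
  calc (n : ℝ) = ∑ j ∈ Finset.range n, (1 : ℝ) := by simp
    _ ≤ ∑ j ∈ Finset.range n, C ^ 2 * ‖hx.measure hB.le (crossMatrix 𝕜 (j + 1))‖ ^ 2 :=
        Finset.sum_le_sum fun j _ => hlow j
    _ ≤ _ := by
        rw [← Finset.mul_sum]
        gcongr
        exact hx.sum_norm_measure_crossMatrix_sq_le hB.le n
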